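/- Let $k\ge 2$ be even, $C\ge 1$, and let $0\ne f\in S_{2k}(\Gamma_0(C))$, with adelization $\Phi_f$ on $GL_2(\mathbb A)$, $\mathbb A=\mathbb A_{\mathbb Q}$ (trivial central character). For each prime $p$ let $\pi_p$ be the representation of $GL_2(\mathbb Q_p)$ generated by $\Phi_f$ under right translation; if $f$ is a Hecke eigen newform, this is the local component at $p$ of the automorphic representation $\pi_f$. Assume that there are a finite set $S(\pi)$ of primes and continuous unitary characters $\mu_p:\mathbb Q_p^\times\to\mathbb C^\times$ such that $\pi_p\cong\pi(\mu_p,\mu_p^{-1})$ (normalized principal series) for $p\notin S(\pi)$, and $\mu_p^2=1$, $\pi_p\cong \mathrm{St}_p\otimes\mu_p$, the irreducible subrepresentation of $\pi(\mu_p|\cdot|^{1/2},\mu_p|\cdot|^{-1/2})$, for $p\in S(\pi)$. (For a newform $f$ this says that $\pi_f$ has no supercuspidal local component.) Let $G_2$ be the split group of type $G_2$, the automorphism group of the split octonions, with simple roots $\alpha$ (short) and $\beta$ (long), and let $P=MN$ be its Heisenberg parabolic subgroup, with $M\cong GL_2$, $\det=3\alpha+2\beta$ on the maximal torus, and modulus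 $\delta_P=|\det|^3$. Put $I(s,\mu)=\mathrm{Ind}_{P(\mathbb Q_p)}^{G_2(\mathbb Q_p)}(\mu\circ\det)|\det|^s$ (normalized induction). Let $\Pi_p=I(0,\mu_p)$ for $p\notin S(\pi)$, let $\Pi_p$ be the maximal proper subrepresentation of $I(\tfrac12,\mu_p)$ for $p\in S(\pi)$, let $\Pi_\infty=D_k$ be the quaternionic discrete series of $G_2(\mathbb R)$ of weight $k$, as a $(\mathfrak g,K_\infty)$-module, and put $\Pi(f)=\Pi_\infty\otimes\bigotimes_p'\Pi_p$. Let $T:\Pi(f)\to\mathcal A(G_2(\mathbb Q)\backslash G_2(\mathbb A))$ be an intertwining map to the space of automorphic forms, let $\phi\in\Pi(f)$ be such that $F:=T(\phi)\neq0$, and let $\Pi_F$ be the representation of $G_2(\mathbb A)$ generated by $F$. Let $S=S(\pi)\cup\{p : p\mid C\}$. For $p\notin S$ the standard $L$-factor $L(s,\Pi_{F,p},\mathrm{St})$ is defined as follows. Let $\chi=\chi_1\otimes\chi_2$ be an unramified character of the torus ($\chi(t)=\chi_1((2\alpha+\beta)(t))\chi_2((\alpha+\beta)(t))$) such that every irreducible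 constituent of $\Pi_F|_{G_2(\mathbb Q_p)}$ is a constituent of the normalized induced representation $\mathrm{Ind}_B^{G_2(\mathbb Q_p)}\chi$ from the Borel subgroup $B$; then $$L(s,\Pi_{F,p},\mathrm{St})=(1-p^{-s})^{-1}\prod_{\gamma\text{ long}}\bigl(1-\chi(\gamma^\vee(p))p^{-s}\bigr)^{-1},$$ the product being over the six long roots $\gamma$. Then for every $p\notin S$ the character $\mu_p$ is unramified, such a $\chi$ exists, and, with $\alpha_p=\mu_p(p)$, $$L(s,\Pi_{F,p},\mathrm{St})=L(s,\mathrm{Sym}^2\pi_p)\,L(s+\tfrac12,\pi_p)\,L(s-\tfrac12,\pi_p)$$ for all $s\in\mathbb C$, where $L(s,\pi_p)=\bigl[(1-\alpha_pp^{-s})(1-\alpha_p^{-1}p^{-s})\bigr]^{-1}$ and $L(s,\mathrm{Sym}^2\pi_p)=\bigl[(1-\alpha_p^2p^{-s})(1-p^{-s})(1-\alpha_p^{-2}p^{-s})\bigr]^{-1}$. Consequently, for $\mathrm{Re}(s)>\tfrac32$ the Euler products $L^S=\prod_{p\notin S}L_p$ converge and $$L^S(s,\Pi_F,\mathrm{St})=L^S(s,\mathrm{Sym}^2\pi_f)\,L^S(s+\tfrac12,\pi_f)\,L^S(s-\tfrac12,\pi_f).$$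 -/

import Mathlib

open scoped RestrictedProduct

noncomputable section

namespace GGLift

instance factPrime (p : Nat.Primes) : Fact (p : ℕ).Prime := ⟨p.2⟩

/-! ## Representations on function spaces -/

/-- Right translation `(R_h φ)(x) = φ (x h)` on all functions on a group. -/
def rightReg (G : Type) [Group G] : Representation ℂ G (G → ℂ) where
  toFun h :=
    { toFun := fun φ x => φ (x * h)
      map_add' := fun _ _ => rfl
      map_smul' := fun _ _ => rfl }
  map_one' := by ext φ x; simp
  map_mul' h₁ h₂ := by ext φ x; simp [mul_assoc]

section Rep
variable {G V : Type} [Group G] [AddCommGroup V] [Module ℂ V]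

/-- The subrepresentation generated by a vector. -/
def cyclicRep (ρ : Representation ℂ G V) (v : V) : Subrepresentation ρ where
  toSubmodule := Submodule.span ℂ (Set.range fun g => ρ g v)
  apply_mem_toSubmodule h w hw := by
    induction hw using Submodule.span_induction with
    | mem x hx =>
      obtain ⟨g, rfl⟩ := hx
      exact Submodule.subset_span ⟨h * g, by simp⟩
    | zero => simp
    | add x y _ _ hx hy => rw [map_add]; exact Submodule.add_mem _ hx hy
    | smul c x _ hx => rw [map_smul]; exact Submodule.smul_mem _ c hx

/-- The sum of all proper subrepresentations of `I`; if `I` has a unique maximal proper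
subrepresentation containing every proper one, this is it. -/
def maximalSub {ρ : Representation ℂ G V} (I : Subrepresentation ρ) : Subrepresentation ρ where
  toSubmodule := Submodule.span ℂ {v | ∃ W : Subrepresentation ρ, W < I ∧ v ∈ W}
  apply_mem_toSubmodule h w hw := by
    induction hw using Submodule.span_induction with
    | mem x hx =>
      obtain ⟨W, hW, hx⟩ := hx
      exact Submodule.subset_span ⟨W, hW, W.apply_mem_toSubmodule h hx⟩
    | zero => simp
    | add x y _ _ hx hy => rw [map_add]; exact Submodule.add_mem _ hx hy
    | smul c x _ hx => rw [map_smul]; exact Submodule.smul_mem _ c hx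

/-- `σ` is (isomorphic to) a subquotient of `ρ`: a quotient of a subrepresentation of `ρ`. -/
def IsSubquotient {U : Type} [AddCommGroup U] [Module ℂ U]
    (σ : Representation ℂ G U) (ρ : Representation ℂ G V) : Prop :=
  ∃ (W : Subrepresentation ρ) (q : Representation.IntertwiningMap W.toRepresentation σ),
    Function.Surjective q

end Rep

/-- Smooth (uniformly locally constant) functions on a totally disconnected group. -/
def IsLocallyInvariant {G : Type} [Group G] [TopologicalSpace G] (φ : G → ℂ) : Prop :=
  ∃ U : Subgroup G, IsOpen (U : Set G) ∧ ∀ u ∈ U, ∀ g, φ (g * u) = φ g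

lemma IsLocallyInvariant.add {G : Type} [Group G] [TopologicalSpace G] {φ ψ : G → ℂ}
    (h₁ : IsLocallyInvariant φ) (h₂ : IsLocallyInvariant ψ) : IsLocallyInvariant (φ + ψ) := by
  obtain ⟨U, hU, h⟩ := h₁
  obtain ⟨U', hU', h'⟩ := h₂
  exact ⟨U ⊓ U', hU.inter hU', fun u hu g => by
    simp [h u hu.1 g, h' u hu.2 g]⟩

lemma IsLocallyInvariant.translate {G : Type} [Group G] [TopologicalSpace G]
    [IsTopologicalGroup G] {φ : G → ℂ} (h₁ : IsLocallyInvariant φ) (h : G) :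
    IsLocallyInvariant (rightReg G h φ) := by
  obtain ⟨U, hU, hφ⟩ := h₁
  refine ⟨U.comap (MulAut.conj h⁻¹).toMonoidHom, ?_, fun u hu g => ?_⟩
  · exact hU.preimage (f := fun x => h⁻¹ * x * h⁻¹⁻¹) (by fun_prop)
  · have := hφ _ hu (g * h)
    simpa [rightReg, mul_assoc] using this

/-- The smooth functions `φ` on a group `G` satisfying `φ (b g) = c φ(g)` for all `(b, c)` in a
given set of pairs, under right translation. -/
def inducedRep {G : Type} [Group G] [TopologicalSpace G] [IsTopologicalGroup G]
    (X : Set (G × ℂ)) : Subrepresentation (rightReg G) where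
  toSubmodule :=
    { carrier := {φ | IsLocallyInvariant φ ∧ ∀ bc ∈ X, ∀ g, φ (bc.1 * g) = bc.2 * φ g}
      zero_mem' := ⟨⟨⊤, isOpen_univ, by simp⟩, by simp⟩
      add_mem' := fun {φ ψ} h h' => ⟨h.1.add h'.1, fun bc hbc g => by
        simp [h.2 bc hbc g, h'.2 bc hbc g, mul_add]⟩
      smul_mem' := fun c φ h => ⟨by
          obtain ⟨⟨U, hU, hφ⟩, -⟩ := h
          exact ⟨U, hU, fun u hu g => by simp [hφ u hu g]⟩, fun bc hbc g => by
          simp [h.2 bc hbc g, mul_left_comm]⟩ }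
  apply_mem_toSubmodule h φ hφ :=
    ⟨hφ.1.translate h, fun bc hbc g => by
      have := hφ.2 bc hbc (g * h)
      simpa [rightReg, mul_assoc] using this⟩

/-! ## Quasi-characters -/

section Char
variable (p : Nat.Primes)

/-- The quasi-character `u ↦ μ(u) |u|^t` of `ℚ_pˣ`. -/
def twist {p : Nat.Primes} (μ : ℚ_[p]ˣ →* ℂˣ) (t : ℝ) (u : ℚ_[p]ˣ) : ℂ :=
  (μ u : ℂ) * ((‖(u : ℚ_[p])‖ ^ t : ℝ) : ℂ)

/-- The prime `p` as an element of `ℚ_pˣ`. -/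
def uniformizer : ℚ_[p]ˣ :=
  Units.mk0 ((p : ℕ) : ℚ_[p]) (by exact_mod_cast p.2.ne_zero)

/-- `μ` is trivial on `ℤ_pˣ`. -/
def IsUnramified {p : Nat.Primes} (μ : ℚ_[p]ˣ →* ℂˣ) : Prop :=
  ∀ u : ℚ_[p]ˣ, ‖(u : ℚ_[p])‖ = 1 → μ u = 1

end Char

/-! ## `GL₂` over the adeles and the representation of a cusp form -/

/-- `GL₂(ℤ_p)` inside `GL₂(ℚ_p)`. -/
def gl2Zp (p : Nat.Primes) : Subgroup (GL (Fin 2) ℚ_[p]) :=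
  (Matrix.GeneralLinearGroup.map (n := Fin 2) (algebraMap ℤ_[p] ℚ_[p])).range

/-- `GL₂` of the finite adeles of `ℚ`. -/
abbrev GL2Af : Type := Πʳ p : Nat.Primes, [GL (Fin 2) ℚ_[p], gl2Zp p]

/-- `GL₂` of the adeles of `ℚ`. -/
abbrev GL2A : Type := GL (Fin 2) ℝ × GL2Af

/-- `GL₂(ℚ_p) → GL₂(𝔸)`. -/
def gl2Incl (p : Nat.Primes) : GL (Fin 2) ℚ_[p] →* GL2A where
  toFun h := (1, RestrictedProduct.mulSingle gl2Zp p h)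
  map_one' := by simp
  map_mul' x y := by simp [RestrictedProduct.mulSingle_mul]

/-- `δ ∈ GL₂(𝔸)` is the diagonal image of `γ ∈ GL₂(ℚ)`. -/
def IsDiagGL2 (γ : GL (Fin 2) ℚ) (δ : GL2A) : Prop :=
  δ.1 = Matrix.GeneralLinearGroup.map (algebraMap ℚ ℝ) γ ∧
    ∀ p : Nat.Primes, δ.2 p = Matrix.GeneralLinearGroup.map (algebraMap ℚ ℚ_[p]) γ

/-- `κ` lies in `K₀(C) ⊆ GL₂(ℤ^)`: lower left entry divisible by `C`. -/
def IsK0 (C : ℕ) (κ : GL2Af) : Prop :=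
  ∀ p, κ p ∈ gl2Zp p ∧ ‖(κ p) 1 0‖ ≤ ‖(C : ℚ_[p])‖

/-- `Γ₀(C)` as a subgroup of `GL₂(ℝ)`. -/
abbrev Gamma0R (C : ℕ) : Subgroup (GL (Fin 2) ℝ) :=
  (CongruenceSubgroup.Gamma0 C).map (Matrix.SpecialLinearGroup.mapGL ℝ)

/-- `Φ` is the function on `GL₂(ℚ)\GL₂(𝔸)` attached to the cusp form `f` of weight `2k` on
`Γ₀(C)`: `Φ(γ g κ) = det(g)^k j(g,i)^{-2k} f(g i)` for `γ ∈ GL₂(ℚ)`, `g ∈ GL₂(ℝ)⁺`, `κ ∈ K₀(C)`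
(this determines `Φ` by strong approximation). -/
structure IsAdelization (C k : ℕ) (f : CuspForm (Gamma0R C) ((2 * k : ℕ) : ℤ))
    (Φ : GL2A → ℂ) : Prop where
  left_inv : ∀ γ δ, IsDiagGL2 γ δ → ∀ x, Φ (δ * x) = Φ x
  right_inv : ∀ κ, IsK0 C κ → ∀ x, Φ (x * (1, κ)) = Φ x
  at_infinity : ∀ g : GL (Fin 2) ℝ, 0 < (g.det : ℝ) →
    Φ (g, 1) = ((g.det : ℝ) : ℂ) ^ k * (UpperHalfPlane.denom g UpperHalfPlane.I ^ (2 * k))⁻¹ *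
      f (g • UpperHalfPlane.I)

/-- The representation of `GL₂(ℚ_p)` generated by `Φ` under right translation. For the
adelization `Φ` of a Hecke eigen newform `f`, which is a pure tensor in `π_f = ⊗' π_p`, this is
the local component `π_p`. -/
def gl2Local (Φ : GL2A → ℂ) (p : Nat.Primes) :
    Subrepresentation ((rightReg GL2A).comp (gl2Incl p)) :=
  cyclicRep _ Φ

/-- The normalized principal series of `GL₂(ℚ_p)`:
smooth `φ` with `φ ((a b; 0 d) g) = χ₁(a) χ₂(d) |a/d|^{1/2} φ(g)`. -/
def gl2Ind (p : Nat.Primes) (χ₁ χ₂ : ℚ_[p]ˣ → ℂ) :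
    Subrepresentation (rightReg (GL (Fin 2) ℚ_[p])) :=
  inducedRep {bc | ∃ a d : ℚ_[p]ˣ, bc.1 1 0 = 0 ∧ bc.1 0 0 = a ∧ bc.1 1 1 = d ∧
    bc.2 = χ₁ a * χ₂ d * (((‖(a : ℚ_[p])‖ / ‖(d : ℚ_[p])‖) ^ (1 / 2 : ℝ) : ℝ) : ℂ)}

/-- `π ≅ π(μ, μ⁻¹)`. -/
def IsPrincipalSeries {p : Nat.Primes} {V : Type} [AddCommGroup V] [Module ℂ V]
    (π : Representation ℂ (GL (Fin 2) ℚ_[p]) V) (μ : ℚ_[p]ˣ →* ℂˣ) : Prop :=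
  Nonempty (π.Equiv (gl2Ind p (twist μ 0) (twist μ⁻¹ 0)).toRepresentation)

/-- `π ≅ St ⊗ μ`, the irreducible subrepresentation of `π(μ|·|^{1/2}, μ|·|^{-1/2})`. -/
def IsTwistedSteinberg {p : Nat.Primes} {V : Type} [AddCommGroup V] [Module ℂ V]
    (π : Representation ℂ (GL (Fin 2) ℚ_[p]) V) (μ : ℚ_[p]ˣ →* ℂˣ) : Prop :=
  ∃ U : Subrepresentation (rightReg (GL (Fin 2) ℚ_[p])),
    U ≤ gl2Ind p (twist μ (1 / 2)) (twist μ (-1 / 2)) ∧ U.toRepresentation.IsIrreducible ∧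
      Nonempty (π.Equiv U.toRepresentation)

/-! ## The split group `G₂` -/

/-- The product of the split octonion algebra, in Zorn's vector matrices
`(a, v; w, d)` with coordinates `a = x 0`, `v = (x 1, x 2, x 3)`, `w = (x 4, x 5, x 6)`, `d = x 7`:
`(a,v;w,d)(a',v';w',d') = (aa' + v·w', av' + d'v - w×w'; a'w + dw' + v×v', dd' + w·v')`. -/
def octMul {R : Type} [CommRing R] (x y : Fin 8 → R) : Fin 8 → R :=
  ![x 0 * y 0 + (x 1 * y 4 + x 2 * y 5 + x 3 * y 6),
    x 0 * y 1 + y 7 * x 1 - (x 5 * y 6 - x 6 * y 5),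
    x 0 * y 2 + y 7 * x 2 - (x 6 * y 4 - x 4 * y 6),
    x 0 * y 3 + y 7 * x 3 - (x 4 * y 5 - x 5 * y 4),
    y 0 * x 4 + x 7 * y 4 + (x 2 * y 3 - x 3 * y 2),
    y 0 * x 5 + x 7 * y 5 + (x 3 * y 1 - x 1 * y 3),
    y 0 * x 6 + x 7 * y 6 + (x 1 * y 2 - x 2 * y 1),
    x 7 * y 7 + (x 4 * y 1 + x 5 * y 2 + x 6 * y 3)]

/-- `G₂(R)`: the automorphism group of the split octonion algebra over `R`. -/
def G2 (R : Type) [CommRing R] : Subgroup (GL (Fin 8) R) where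
  carrier := {g | ∀ x y, g.1.mulVec (octMul x y) = octMul (g.1.mulVec x) (g.1.mulVec y)}
  one_mem' := by simp
  mul_mem' {g h} hg hh x y := by
    have e : ∀ v, (g * h).1.mulVec v = g.1.mulVec (h.1.mulVec v) := fun v => by simp
    rw [e, e, e, hh, hg]
  inv_mem' {g} hg x y := by
    have e : ∀ v, g.1.mulVec ((g⁻¹).1.mulVec v) = v := fun v => by
      rw [Matrix.mulVec_mulVec, ← Units.val_mul, mul_inv_cancel]; simp
    have e' : ∀ v, (g⁻¹).1.mulVec (g.1.mulVec v) = v := fun v => by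
      rw [Matrix.mulVec_mulVec, ← Units.val_mul, inv_mul_cancel]; simp
    rw [← e' (octMul ((g⁻¹).1.mulVec x) _), hg, e, e]

/-- Matrix entries of an element of `G₂(R)`. The basis vector `1` has weight `α + β`, the basis
vector `6` has weight `2α + β` and the basis vector `2` has weight `α`
(`α` short, `β` long simple root). -/
def ent {R : Type} [CommRing R] (g : G2 R) (i j : Fin 8) : R := g.1.1 i j

/-- The Heisenberg parabolic `P = MN` (stabilizer of the highest root line, the long root
`3α + 2β`): the stabilizer of the null plane spanned by the basis vectors `1` and `6`. -/
def InP {R : Type} [CommRing R] (g : G2 R) : Prop :=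
  ∀ i, i ≠ 1 → i ≠ 6 → ent g i 1 = 0 ∧ ent g i 6 = 0

/-- The character `det` of `P` (the determinant on that plane, i.e. the determinant of the Levi
factor `M ≅ GL₂`; on the torus it is `3α + 2β`). The modulus character of `P` is `|det|³`. -/
def detP {R : Type} [CommRing R] (g : G2 R) : R :=
  ent g 1 1 * ent g 6 6 - ent g 1 6 * ent g 6 1

/-- The Borel subgroup `B ⊆ P`, also stabilizing the line through the basis vector `6`. -/
def InB {R : Type} [CommRing R] (g : G2 R) : Prop := InP g ∧ ent g 1 6 = 0

/-! ### Smooth functions and differential operators on `G₂(ℝ)` -/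

/-- One-parameter subgroups of `G₂(ℝ)`; they correspond to elements of its Lie algebra. -/
abbrev OneParam : Type := Multiplicative ℝ →ₜ* G2 ℝ

/-- The derivative of `φ` along the left-invariant vector field of `c`. -/
def lieDeriv (c : OneParam) (φ : G2 ℝ → ℂ) (g : G2 ℝ) : ℂ :=
  deriv (fun t : ℝ => φ (g * c (Multiplicative.ofAdd t))) 0

def IsDiffAlong (c : OneParam) (φ : G2 ℝ → ℂ) : Prop :=
  ∀ g, DifferentiableAt ℝ (fun t : ℝ => φ (g * c (Multiplicative.ofAdd t))) 0

lemma lieDeriv_add {c : OneParam} {φ ψ : G2 ℝ → ℂ} (h : IsDiffAlong c φ)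
    (h' : IsDiffAlong c ψ) : lieDeriv c (φ + ψ) = lieDeriv c φ + lieDeriv c ψ := by
  funext g
  exact deriv_add (h g) (h' g)

lemma lieDeriv_smul {c : OneParam} {φ : G2 ℝ → ℂ} (a : ℂ) (h : IsDiffAlong c φ) :
    lieDeriv c (a • φ) = a • lieDeriv c φ := by
  funext g
  exact deriv_const_smul a (h g)

/-- Functions of class `Cⁿ` on the Lie group `G₂(ℝ)`: all iterated derivatives of order `≤ n`
along left-invariant vector fields exist and are continuous. -/
def smoothOfOrder : ℕ → Submodule ℂ (G2 ℝ → ℂ)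
  | 0 =>
    { carrier := {φ | Continuous φ}
      zero_mem' := continuous_zero
      add_mem' := fun h h' => Continuous.add h h'
      smul_mem' := fun a _ h => Continuous.const_smul h a }
  | n + 1 =>
    { carrier := {φ | Continuous φ ∧
        ∀ c : OneParam, IsDiffAlong c φ ∧ lieDeriv c φ ∈ smoothOfOrder n}
      zero_mem' := ⟨continuous_zero, fun c => ⟨fun g => by simp, by
        have : lieDeriv c 0 = 0 := by funext g; simp [lieDeriv]
        rw [this]; exact Submodule.zero_mem _⟩⟩
      add_mem' := fun {φ ψ} h h' => ⟨h.1.add h'.1, fun c =>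
        ⟨fun g => ((h.2 c).1 g).add ((h'.2 c).1 g), by
          rw [lieDeriv_add (h.2 c).1 (h'.2 c).1]
          exact Submodule.add_mem _ (h.2 c).2 (h'.2 c).2⟩⟩
      smul_mem' := fun a φ h => ⟨h.1.const_smul a, fun c =>
        ⟨fun g => ((h.2 c).1 g).const_smul a, by
          rw [lieDeriv_smul a (h.2 c).1]
          exact Submodule.smul_mem _ a (h.2 c).2⟩⟩ }

/-- `C^∞(G₂(ℝ))`. -/
def smoothFns : Submodule ℂ (G2 ℝ → ℂ) := ⨅ n, smoothOfOrder n

lemma smooth_diff {φ : G2 ℝ → ℂ} (h : φ ∈ smoothFns) (c : OneParam) : IsDiffAlong c φ :=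
  (((Submodule.mem_iInf _).1 h 1).2 c).1

lemma smooth_lieDeriv {φ : G2 ℝ → ℂ} (h : φ ∈ smoothFns) (c : OneParam) :
    lieDeriv c φ ∈ smoothFns :=
  (Submodule.mem_iInf _).2 fun n => (((Submodule.mem_iInf _).1 h (n + 1)).2 c).2

/-- The Lie derivative as an operator on `C^∞(G₂(ℝ))`. -/
def lieOp (c : OneParam) : Module.End ℂ smoothFns where
  toFun φ := ⟨lieDeriv c φ.1, smooth_lieDeriv φ.2 c⟩
  map_add' φ ψ := Subtype.ext (lieDeriv_add (smooth_diff φ.2 c) (smooth_diff ψ.2 c))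
  map_smul' a φ := Subtype.ext (lieDeriv_smul a (smooth_diff φ.2 c))

/-- `U(𝔤)`, as the algebra of left-invariant differential operators on `C^∞(G₂(ℝ))`
generated by the complexified Lie algebra. -/
def envelopingAlg : Subalgebra ℂ (Module.End ℂ smoothFns) := Algebra.adjoin ℂ (Set.range lieOp)

/-- `Z(𝔤)`, the center of `U(𝔤)`. -/
abbrev centerAlg : Subalgebra ℂ envelopingAlg := Subalgebra.center ℂ envelopingAlg

/-! ### The maximal compact subgroup and quaternionic discrete series -/

/-- The maximal compact subgroup `K_∞ = G₂(ℝ) ∩ O(8)` of `G₂(ℝ)`. -/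
def Kinf : Subgroup (G2 ℝ) where
  carrier := {g | g.1.1 * g.1.1.transpose = 1}
  one_mem' := by simp
  mul_mem' {g h} hg hh := by
    simp only [Set.mem_ofPred_eq] at *
    have : (g * h).1.1 = g.1.1 * h.1.1 := rfl
    rw [this, Matrix.transpose_mul, Matrix.mul_assoc, ← Matrix.mul_assoc h.1.1, hh,
      Matrix.one_mul, hg]
  inv_mem' {g} hg := by
    simp only [Set.mem_ofPred_eq] at *
    have e : (g⁻¹).1.1 * g.1.1 = 1 := by
      have : (g⁻¹ * g).1.1 = 1 := by simp
      exact this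
    have h1 : (g⁻¹).1.1 = g.1.1.transpose := by
      calc (g⁻¹).1.1 = (g⁻¹).1.1 * (g.1.1 * g.1.1.transpose) := by rw [hg, Matrix.mul_one]
        _ = g.1.1.transpose := by rw [← Matrix.mul_assoc, e, Matrix.one_mul]
    rw [← h1] at hg
    rw [h1, Matrix.transpose_transpose, ← h1, e]

/-- The factor `SU(2)_{3α+2β}` of `K_∞ ≅ (SU(2)_{3α+2β} × SU(2)_α)/μ₂` attached to the long root:
the automorphisms fixing pointwise the definite quaternion subalgebra `{(a, v; -v, a)}`. -/
def InSU2Long (g : G2 ℝ) : Prop :=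
  ∀ (a : ℝ) (v : Fin 3 → ℝ),
    g.1.1.mulVec ![a, v 0, v 1, v 2, -v 0, -v 1, -v 2, a] =
      ![a, v 0, v 1, v 2, -v 0, -v 1, -v 2, a]

/-- The factor `SU(2)_α` of `K_∞` attached to the short root: the centralizer of `SU(2)_{3α+2β}`
in `K_∞`. -/
def InSU2Short (g : G2 ℝ) : Prop := g ∈ Kinf ∧ ∀ h, InSU2Long h → g * h = h * g

/-- `φ` is a smooth vector of the (unnormalized) degenerate principal series
`ind_P^{G₂(ℝ)} λ_k`, `λ_k = sgn(det)^k |det|^{k+1}`. -/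
def InIndLambda (k : ℕ) (φ : G2 ℝ → ℂ) : Prop :=
  φ ∈ smoothFns ∧ ∀ q g, InP q →
    φ (q * g) = ((Real.sign (detP q) ^ k * |detP q| ^ (k + 1) : ℝ) : ℂ) * φ g

/-- The right translates of `φ` by `K_∞` span a copy of the `K_∞`-type
`V_k = Sym^{2k}(ℂ²) ⊠ 1`. -/
def GeneratesVk (k : ℕ) (φ : G2 ℝ → ℂ) : Prop :=
  (∀ κ, InSU2Short κ → rightReg (G2 ℝ) κ φ = φ) ∧
    (cyclicRep ((rightReg (G2 ℝ)).comp Kinf.subtype) φ).toRepresentation.IsIrreducible ∧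
    Module.finrank ℂ (cyclicRep ((rightReg (G2 ℝ)).comp Kinf.subtype) φ).toSubmodule = 2 * k + 1

/-- The quaternionic discrete series `D_k`, as a `(𝔤, K_∞)`-module: the `(𝔤, K_∞)`-submodule of
`ind_P^{G₂(ℝ)} λ_k` generated by its minimal `K_∞`-type `V_k` (which has multiplicity one). -/
def Dk (k : ℕ) : Submodule ℂ (G2 ℝ → ℂ) :=
  sInf {W | (∀ φ, InIndLambda k φ → GeneratesVk k φ → φ ∈ W) ∧
    (∀ κ ∈ Kinf, ∀ φ ∈ W, rightReg (G2 ℝ) κ φ ∈ W) ∧ ∀ c, ∀ φ ∈ W, lieDeriv c φ ∈ W}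

/-! ### `p`-adic representations -/

/-- `G₂(ℤ_p)` inside `G₂(ℚ_p)`. -/
def g2Zp (p : Nat.Primes) : Subgroup (G2 ℚ_[p]) :=
  (Matrix.GeneralLinearGroup.map (n := Fin 8) (algebraMap ℤ_[p] ℚ_[p])).range.subgroupOf
    (G2 ℚ_[p])

/-- `I(s, μ) = Ind_P^{G₂(ℚ_p)} (μ ∘ det)|det|^s` (normalized). -/
def indP (p : Nat.Primes) (s : ℝ) (μ : ℚ_[p]ˣ →* ℂˣ) :
    Subrepresentation (rightReg (G2 ℚ_[p])) :=
  inducedRep {bc | ∃ u : ℚ_[p]ˣ, InP bc.1 ∧ detP bc.1 = u ∧ bc.2 = twist μ (s + 3 / 2) u}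

/-- `Ind_B^{G₂(ℚ_p)} χ₁ ⊗ χ₂` (normalized), for the character
`t ↦ χ₁((2α+β)(t)) χ₂((α+β)(t))` of the torus; `δ_B^{1/2}(t) = |(2α+β)(t)|² |(α+β)(t)|`. -/
def indB (p : Nat.Primes) (χ₁ χ₂ : ℚ_[p]ˣ →* ℂˣ) : Subrepresentation (rightReg (G2 ℚ_[p])) :=
  inducedRep {bc | ∃ u₁ u₂ : ℚ_[p]ˣ, InB bc.1 ∧ ent bc.1 6 6 = u₁ ∧ ent bc.1 1 1 = u₂ ∧
    bc.2 = twist χ₁ 2 u₁ * twist χ₂ 1 u₂}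

open Classical in
/-- The local components `Π_p` of the lift: `I(0, μ_p)` for `p ∉ S(π)`, the maximal
subrepresentation of `I(1/2, μ_p)` for `p ∈ S(π)`. -/
def localPi (Sπ : Finset Nat.Primes) (μ : ∀ p : Nat.Primes, ℚ_[p]ˣ →* ℂˣ) (p : Nat.Primes) :
    Subrepresentation (rightReg (G2 ℚ_[p])) :=
  if p ∈ Sπ then maximalSub (indP p (1 / 2) (μ p)) else indP p 0 (μ p)

/-! ### The adelic group, the representation `Π(f)`, automorphic forms -/

/-- `G₂` of the finite adeles of `ℚ`. -/
abbrev G2Af : Type := Πʳ p : Nat.Primes, [G2 ℚ_[p], g2Zp p]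

/-- `G₂` of the adeles of `ℚ`. -/
abbrev G2A : Type := G2 ℝ × G2Af

/-- `G₂(ℚ_p) → G₂(𝔸)`. -/
def g2Incl (p : Nat.Primes) : G2 ℚ_[p] →* G2A where
  toFun h := (1, RestrictedProduct.mulSingle g2Zp p h)
  map_one' := by simp
  map_mul' x y := by simp [RestrictedProduct.mulSingle_mul]

/-- `δ ∈ G₂(𝔸)` is the diagonal image of `γ ∈ G₂(ℚ)`. -/
def IsDiagG2 (γ : G2 ℚ) (δ : G2A) : Prop :=
  (δ.1 : GL (Fin 8) ℝ) = Matrix.GeneralLinearGroup.map (algebraMap ℚ ℝ) γ.1 ∧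
    ∀ p : Nat.Primes, (δ.2 p : GL (Fin 8) ℚ_[p]) = Matrix.GeneralLinearGroup.map (algebraMap ℚ ℚ_[p]) γ.1

/-- The action of the Lie algebra of `G₂(ℝ)` on functions on `G₂(𝔸)`. -/
def lieDerivA (c : OneParam) (F : G2A → ℂ) (x : G2A) : ℂ :=
  lieDeriv c (fun g => F (g, x.2)) x.1

/-- The admissible representation `Π(f) = D_k ⊗ ⊗'_p Π_p` of `G₂(𝔸)`. Since every factor is a
space of functions, the restricted tensor product (with respect to the `G₂(ℤ_p)`-invariant
vectors with value `1` at `1`) is realized as the span of the products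
`x ↦ φ_∞(x_∞) ∏_p φ_p(x_p)`. -/
def globalPi (k : ℕ) (Sπ : Finset Nat.Primes) (μ : ∀ p : Nat.Primes, ℚ_[p]ˣ →* ℂˣ) :
    Submodule ℂ (G2A → ℂ) :=
  Submodule.span ℂ {φ | ∃ φinf ∈ Dk k, ∃ φp : ∀ p : Nat.Primes, G2 ℚ_[p] → ℂ,
    (∀ p, φp p ∈ localPi Sπ μ p) ∧
    (∀ᶠ p in Filter.cofinite, φp p 1 = 1 ∧ ∀ κ ∈ g2Zp p, ∀ g, φp p (g * κ) = φp p g) ∧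
    φ = fun x => φinf x.1 * ∏ᶠ p, φp p (x.2 p)}

/-- Automorphic forms on `G₂(ℚ)\G₂(𝔸)`. -/
structure IsAutomorphicForm (F : G2A → ℂ) : Prop where
  left_inv : ∀ γ δ, IsDiagG2 γ δ → ∀ x, F (δ * x) = F x
  smooth : ∀ y, (fun g => F (g, y)) ∈ smoothFns
  level : ∃ U : Subgroup G2Af, IsOpen (U : Set G2Af) ∧ ∀ u ∈ U, ∀ x, F (x * (1, u)) = F x
  K_finite : FiniteDimensional ℂ
    (Submodule.span ℂ (Set.range fun κ : Kinf => rightReg G2A ((κ : G2 ℝ), 1) F))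
  Z_finite : FiniteDimensional ℂ (Submodule.span ℂ (Set.range
    fun (z : centerAlg) (y : G2Af) => (z : Module.End ℂ smoothFns) ⟨fun g => F (g, y), smooth y⟩))
  growth : ∀ y, ∃ (A : ℝ) (N : ℕ), ∀ g,
    ‖F (g, y)‖ ≤ A * (∑ i, ∑ j, (|ent g i j| + |ent g⁻¹ i j|)) ^ N

/-- `T : Π(f) → 𝒜(G₂(ℚ)\G₂(𝔸))` is an intertwining map: linear and equivariant for
`G₂(𝔸_f)`, for `K_∞` and for the Lie algebra of `G₂(ℝ)`. -/
structure IsIntertwiner {E : Submodule ℂ (G2A → ℂ)} (T : E →ₗ[ℂ] (G2A → ℂ)) : Prop where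
  automorphic : ∀ φ, IsAutomorphicForm (T φ)
  finite_equiv : ∀ (h : G2Af) (φ φ' : E), (φ' : G2A → ℂ) = rightReg G2A (1, h) φ →
    T φ' = rightReg G2A (1, h) (T φ)
  compact_equiv : ∀ κ ∈ Kinf, ∀ φ φ' : E, (φ' : G2A → ℂ) = rightReg G2A (κ, 1) φ →
    T φ' = rightReg G2A (κ, 1) (T φ)
  lie_equiv : ∀ (c : OneParam) (φ φ' : E), (φ' : G2A → ℂ) = lieDerivA c φ →
    T φ' = lieDerivA c (T φ)

/-- A space of functions on `G₂(𝔸)` stable under `G₂(𝔸_f)`, `K_∞` and the Lie algebra. -/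
def IsAdelicStable (W : Submodule ℂ (G2A → ℂ)) : Prop :=
  (∀ h : G2Af, ∀ F ∈ W, rightReg G2A (1, h) F ∈ W) ∧
    (∀ κ ∈ Kinf, ∀ F ∈ W, rightReg G2A (κ, 1) F ∈ W) ∧
    ∀ c : OneParam, ∀ F ∈ W, lieDerivA c F ∈ W

/-- The representation `Π_F` of `G₂(𝔸)` generated by `F`, viewed as a representation of
`G₂(ℚ_p)`. -/
def generatedRep (F : G2A → ℂ) (p : Nat.Primes) :
    Subrepresentation ((rightReg G2A).comp (g2Incl p)) where
  toSubmodule := sInf {W | IsAdelicStable W ∧ F ∈ W}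
  apply_mem_toSubmodule h v hv := by
    simp only [Submodule.mem_sInf, Set.mem_ofPred_eq] at *
    exact fun W hW => hW.1.1 _ v (hv W hW)

/-! ## `L`-functions -/

/-- The factor `det(1 - r₇(t) X)⁻¹` for the degree `7` standard representation `r₇` of the dual
group and the Satake parameter `t` of `Ind_B χ₁ ⊗ χ₂`, `χ₁(p) = a`, `χ₂(p) = b`. The weights of
`r₇` are `0` and the coroots `γ^∨` of the long roots `γ` of `G₂`. These coroots are the cocharacters
`e_i - e_j` of the diagonal torus of `SL₃ ⊆ G₂` acting on `v = (x 1, x 2, x 3)`; the character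
sends `n = (n₁, n₂, n₃)`, evaluated at `p`, to `χ₁(p^{-n₃}) χ₂(p^{n₁})`. -/
def stdEulerFactor (a b X : ℂ) : ℂ :=
  (1 - X)⁻¹ * ∏ ij ∈ (Finset.univ : Finset (Fin 3)).offDiag,
    (1 - a ^ (-((Pi.single ij.1 1 - Pi.single ij.2 1 : Fin 3 → ℤ) 2)) *
      b ^ ((Pi.single ij.1 1 - Pi.single ij.2 1 : Fin 3 → ℤ) 0) * X)⁻¹

/-- `L` is the standard `L`-factor `s ↦ L(s, ρ, St)` of a nonzero isotypic (e.g. irreducible)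
representation `ρ` of `G₂(ℚ_p)`: the irreducible constituent of `ρ` is a constituent of an
unramified principal series `Ind_B χ₁ ⊗ χ₂`, whose Satake parameter gives `L`. For unramified
representations (those with a nonzero `G₂(ℤ_p)`-fixed vector), the only ones it is used for, this
is the usual definition; `(χ₁, χ₂)` is then unique up to the Weyl group and `L` is unique. -/
def IsStdLFactor {p : Nat.Primes} {V : Type} [AddCommGroup V] [Module ℂ V]
    (ρ : Representation ℂ (G2 ℚ_[p]) V) (L : ℂ → ℂ) : Prop :=
  Nontrivial V ∧ ∃ χ₁ χ₂ : ℚ_[p]ˣ →* ℂˣ, IsUnramified χ₁ ∧ IsUnramified χ₂ ∧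
    (∀ (U : Type) [AddCommGroup U] [Module ℂ U] (σ : Representation ℂ (G2 ℚ_[p]) U),
      σ.IsIrreducible → IsSubquotient σ ρ → IsSubquotient σ (indB p χ₁ χ₂).toRepresentation) ∧
    ∀ s : ℂ, L s = stdEulerFactor (χ₁ (uniformizer p)) (χ₂ (uniformizer p))
      (((p : ℕ) : ℂ) ^ (-s))

/-- `L(s, π(μ, μ⁻¹))` for unramified `μ` with `μ(p) = α`. -/
def gl2LFactor (p : Nat.Primes) (α s : ℂ) : ℂ :=
  ((1 - α * ((p : ℕ) : ℂ) ^ (-s)) * (1 - α⁻¹ * ((p : ℕ) : ℂ) ^ (-s)))⁻¹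

/-- `L(s, Sym² π(μ, μ⁻¹))` for unramified `μ` with `μ(p) = α`. -/
def sym2LFactor (p : Nat.Primes) (α s : ℂ) : ℂ :=
  ((1 - α ^ 2 * ((p : ℕ) : ℂ) ^ (-s)) * (1 - ((p : ℕ) : ℂ) ^ (-s)) *
    (1 - (α⁻¹) ^ 2 * ((p : ℕ) : ℂ) ^ (-s)))⁻¹

end GGLift

end

open GGLift

namespace GGLift

/-! Fix $p\notin S$. Since $p\nmid C$, $\Phi_f$ is fixed by $GL_2(\mathbb Z_p)$, so
$\pi(\mu_p,\mu_p^{-1})$ has a nonzero spherical vector, which forces $\mu_p$ to be unramified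
(`isUnramified_of_isPrincipalSeries`).

$\Pi_F$ lies in the image of $T$. Fixing all factors of a pure tensor except the one at $p$ gives a
$G_2(\mathbb Q_p)$-map $\Pi_p\to\Pi(f)$, so the image of $T$ is a sum of equivariant images of
$\Pi_p$. An irreducible constituent of such a sum is a constituent of $\Pi_p$
(`IsSubquotient.of_forall_mem_span`); neither irreducibility nor admissibility of $\Pi_p$ enters.

Restricting equivariance from $P$ to $B$ embeds $\Pi_p=I(0,\mu_p)$ in
$\mathrm{Ind}_B\,\mu_p|\cdot|^{-1/2}\otimes\mu_p|\cdot|^{1/2}$ (`indP_le_indB`). As $|p|=p^{-1}$,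
the Satake parameters are $a=\alpha_pp^{1/2}$, $b=\alpha_pp^{-1/2}$, and the weights
$1,a^{\pm1},b^{\pm1},(ab)^{\pm1}$ regroup into the three factors (`stdEulerFactor_lift`). Unitarity
gives $|\alpha_p|=1$, whence convergence. -/

open Representation

/-! ### Constituents of a sum of equivariant images -/

section Subquotient

variable {G X U V : Type} [Group G] [AddCommGroup X] [Module ℂ X] [AddCommGroup U] [Module ℂ U]
  [AddCommGroup V] [Module ℂ V]

/-- A stable correspondence `R ⊆ X × U` which is functional and onto `U` exhibits `U` as a
subquotient of `X`. -/
lemma isSubquotient_of_correspondence {ρ : Representation ℂ G X} {σ : Representation ℂ G U}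
    (R : Submodule ℂ (X × U)) (hR : ∀ g x u, (x, u) ∈ R → (ρ g x, σ g u) ∈ R)
    (hfun : ∀ u, (0, u) ∈ R → u = 0) (hsurj : ∀ u, ∃ x, (x, u) ∈ R) : IsSubquotient σ ρ := by
  have huniq : ∀ {x u u'}, (x, u) ∈ R → (x, u') ∈ R → u = u' := fun {x u u'} h h' =>
    sub_eq_zero.1 (hfun _ (by simpa using R.sub_mem h h'))
  let W : Subrepresentation ρ :=
    { toSubmodule := R.map (LinearMap.fst ℂ X U)
      apply_mem_toSubmodule := by
        rintro g _ ⟨⟨x, u⟩, h, rfl⟩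
        exact ⟨_, hR g x u h, rfl⟩ }
  have hW : ∀ w : W.toSubmodule, ∃ u, ((w : X), u) ∈ R := by
    rintro ⟨_, ⟨⟨x, u⟩, h, rfl⟩⟩
    exact ⟨u, h⟩
  choose q hq using hW
  let q' : W.toSubmodule →ₗ[ℂ] U :=
    { toFun := q
      map_add' := fun a b => huniq (hq (a + b)) (R.add_mem (hq a) (hq b))
      map_smul' := fun c a => huniq (hq (c • a)) (R.smul_mem c (hq a)) }
  refine ⟨W, q'.intertwiningMap_of_isIntertwiningMap _ _ fun g w =>
    huniq (hq (W.toRepresentation g w)) (hR g _ _ (hq w)), fun u => ?_⟩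
  obtain ⟨x, hx⟩ := hsurj u
  exact ⟨⟨x, ⟨_, hx, rfl⟩⟩, huniq (hq ⟨x, ⟨_, hx, rfl⟩⟩) hx⟩

/-- For irreducible `U` a functional stable correspondence need only hit a nonzero vector. -/
lemma isSubquotient_of_correspondence_of_irreducible {ρ : Representation ℂ G X}
    {σ : Representation ℂ G U} (hσ : σ.IsIrreducible)
    (R : Submodule ℂ (X × U)) (hR : ∀ g x u, (x, u) ∈ R → (ρ g x, σ g u) ∈ R)
    (hfun : ∀ u, (0, u) ∈ R → u = 0) {x : X} {u : U} (h : (x, u) ∈ R) (hu : u ≠ 0) :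
    IsSubquotient σ ρ := by
  refine isSubquotient_of_correspondence R hR hfun fun v => ?_
  let Y : Subrepresentation σ :=
    { toSubmodule := R.map (LinearMap.snd ℂ X U)
      apply_mem_toSubmodule := by
        rintro g _ ⟨⟨x, u⟩, h, rfl⟩
        exact ⟨_, hR g x u h, rfl⟩ }
  have huY : u ∈ Y := ⟨_, h, rfl⟩
  have hY : Y = ⊤ := (eq_bot_or_eq_top Y).resolve_left fun hbot => hu (by
    rw [hbot] at huY; exact huY)
  have hv : v ∈ Y := by rw [hY]; exact Submodule.mem_top (R := ℂ)
  obtain ⟨⟨x', _⟩, h', rfl⟩ := hv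
  exact ⟨x', h'⟩

/-- The vectors of `ρ` that are images of vectors of `τ` under equivariant maps. -/
def equivariantImages (τ : Representation ℂ G V) (ρ : Representation ℂ G X) : Set X :=
  {x | ∃ (f : V →ₗ[ℂ] X) (v : V), (∀ g w, f (τ g w) = ρ g (f w)) ∧ f v = x}

/-- If a functional stable correspondence from `X` to an irreducible `U` relates a finite sum of
images of vectors of `V` under equivariant maps to a nonzero vector, then `U` is a subquotient
of `V`. -/
lemma isSubquotient_of_sum_images {τ : Representation ℂ G V} {ρ : Representation ℂ G X}
    {σ : Representation ℂ G U} (hσ : σ.IsIrreducible) {x : X}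
    (hx : x ∈ AddSubmonoid.closure (equivariantImages τ ρ)) :
    ∀ (R : Submodule ℂ (X × U)), (∀ g x u, (x, u) ∈ R → (ρ g x, σ g u) ∈ R) →
      (∀ u, (0, u) ∈ R → u = 0) → ∀ u, (x, u) ∈ R → u ≠ 0 → IsSubquotient σ τ := by
  induction hx using AddSubmonoid.closure_induction_left with
  | zero => exact fun R _ hfun u h hu => (hu (hfun u h)).elim
  | add_left y hy x _ ih =>
    obtain ⟨f, v, hf, rfl⟩ := hy
    intro R hR hfun u h hu
    -- If `R` relates some vector of the image of `f` to a nonzero vector, pulling `R` back along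
    -- `f` exhibits `U` as a subquotient of `V`. Otherwise the image of `f` can be killed without
    -- losing functionality, which removes one summand.
    by_cases hcase : ∃ v' u', (f v', u') ∈ R ∧ u' ≠ 0
    · obtain ⟨v', u', h', hu'⟩ := hcase
      refine isSubquotient_of_correspondence_of_irreducible hσ
        (R.comap (f.prodMap LinearMap.id)) (fun g w u'' hw => ?_) (fun u'' hw => hfun u'' ?_)
        (x := v') (u := u') h' hu'
      · simpa [hf] using hR g _ _ (show (f w, u'') ∈ R from hw)
      · simpa using (show (f 0, u'') ∈ R from hw)
    · push Not at hcase
      refine ih (R ⊔ (LinearMap.range f).prod ⊥) (fun g x' u' hx' => ?_) (fun u' hx' => ?_) u ?_ hu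
      · obtain ⟨⟨a, b⟩, hab, ⟨c, d⟩, ⟨⟨w, rfl⟩, hd⟩, he⟩ := Submodule.mem_sup.1 hx'
        obtain rfl : d = 0 := hd
        simp only [Prod.mk_add_mk, add_zero, Prod.mk.injEq] at he
        obtain ⟨rfl, rfl⟩ := he
        exact Submodule.mem_sup.2 ⟨_, hR g _ _ hab, (ρ g (f w), 0),
          ⟨⟨τ g w, hf g w⟩, rfl⟩, by simp⟩
      · obtain ⟨⟨a, b⟩, hab, ⟨c, d⟩, ⟨⟨w, rfl⟩, hd⟩, he⟩ := Submodule.mem_sup.1 hx'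
        obtain rfl : d = 0 := hd
        simp only [Prod.mk_add_mk, add_zero, Prod.mk.injEq] at he
        obtain ⟨he, rfl⟩ := he
        refine hcase (-w) b ?_
        rwa [map_neg, ← eq_neg_of_add_eq_zero_left he]
      · exact Submodule.mem_sup.2 ⟨_, h, (f (-v), 0), ⟨⟨-v, rfl⟩, rfl⟩, by simp⟩

/-- Scalars are absorbed into the vector of `V`, so linear combinations are plain sums, the form
needed for induction on the number of summands. -/
lemma mem_closure_equivariantImages {τ : Representation ℂ G V} {ρ : Representation ℂ G X} {x : X}
    (hx : x ∈ Submodule.span ℂ (equivariantImages τ ρ)) :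
    x ∈ AddSubmonoid.closure (equivariantImages τ ρ) := by
  induction hx using Submodule.span_induction with
  | mem x hx => exact AddSubmonoid.subset_closure hx
  | zero => exact AddSubmonoid.zero_mem _
  | add x y _ _ hx hy => exact AddSubmonoid.add_mem _ hx hy
  | smul a x hmem hx =>
    clear hmem
    induction hx using AddSubmonoid.closure_induction with
    | mem x hx =>
      obtain ⟨f, v, hf, rfl⟩ := hx
      exact AddSubmonoid.subset_closure ⟨f, a • v, hf, map_smul f a v⟩
    | zero => rw [smul_zero]; exact AddSubmonoid.zero_mem _
    | add x y _ _ hx hy => rw [smul_add]; exact AddSubmonoid.add_mem _ hx hy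

/-- If every vector of a subrepresentation `Y` of `ρ` is a finite sum of images of vectors of `τ`
under equivariant maps, every irreducible subquotient of `Y` is one of `τ`. -/
lemma IsSubquotient.of_forall_mem_span {τ : Representation ℂ G V} {ρ : Representation ℂ G X}
    {σ : Representation ℂ G U} (hσ : σ.IsIrreducible) {Y : Subrepresentation ρ}
    (hY : ∀ y ∈ Y, y ∈ Submodule.span ℂ (equivariantImages τ ρ))
    (h : IsSubquotient σ Y.toRepresentation) : IsSubquotient σ τ := by
  obtain ⟨W, q, hq⟩ := h
  have hnt : Nontrivial U := by
    by_contra hnt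
    rw [not_nontrivial_iff_subsingleton] at hnt
    exact bot_ne_top (α := Subrepresentation σ)
      (SetLike.ext fun v => by
        rw [Subsingleton.elim v 0]
        exact ⟨fun _ => Submodule.zero_mem _, fun _ => Submodule.zero_mem _⟩)
  obtain ⟨u, hu⟩ := exists_ne (0 : U)
  obtain ⟨w, rfl⟩ := hq u
  let ι : W.toSubmodule →ₗ[ℂ] X := Y.toSubmodule.subtype ∘ₗ W.toSubmodule.subtype
  refine isSubquotient_of_sum_images hσ (mem_closure_equivariantImages (hY _ w.1.2))
    (LinearMap.range (ι.prod q.toLinearMap)) ?_ ?_ (q w) ⟨w, rfl⟩ hu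
  · rintro g _ _ ⟨w', h⟩
    obtain ⟨rfl, rfl⟩ := Prod.mk.inj h
    exact ⟨W.toRepresentation g w', Prod.ext rfl (IntertwiningMap.isIntertwining _ _ q g w')⟩
  · rintro _ ⟨w', h⟩
    obtain ⟨h0, rfl⟩ := Prod.mk.inj h
    have : w' = 0 := Subtype.ext (Subtype.ext h0)
    simp [this]

lemma IsSubquotient.mono {ρ : Representation ℂ G X} {σ : Representation ℂ G U}
    {Y Z : Subrepresentation ρ} (hYZ : Y ≤ Z) (h : IsSubquotient σ Y.toRepresentation) :
    IsSubquotient σ Z.toRepresentation := by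
  obtain ⟨W, q, hq⟩ := h
  refine isSubquotient_of_correspondence
    (LinearMap.range (((Submodule.inclusion hYZ) ∘ₗ W.toSubmodule.subtype).prod q.toLinearMap))
    ?_ ?_ ?_
  · rintro g _ _ ⟨w', h⟩
    obtain ⟨rfl, rfl⟩ := Prod.mk.inj h
    exact ⟨W.toRepresentation g w', Prod.ext rfl (IntertwiningMap.isIntertwining _ _ q g w')⟩
  · rintro _ ⟨w', h⟩
    obtain ⟨h0, rfl⟩ := Prod.mk.inj h
    have : w' = 0 := Subtype.ext (Submodule.inclusion_injective hYZ (h0.trans (map_zero _).symm))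
    simp [this]
  · intro u
    obtain ⟨w, rfl⟩ := hq u
    exact ⟨_, w, rfl⟩

end Subquotient

/-! ### `D_k` -/

/-- The one-parameter subgroup `t ↦ κ c(t) κ⁻¹`. -/
def conjOneParam (κ : G2 ℝ) (c : OneParam) : OneParam where
  toFun t := κ * c t * κ⁻¹
  map_one' := by simp
  map_mul' s t := by simp [mul_assoc]
  continuous_toFun := by fun_prop

/-- From $g\,c(t)\,\kappa=g\kappa\cdot\kappa^{-1}c(t)\kappa$: translation by $\kappa$ intertwines
Lie derivatives up to the adjoint action. Smoothness quantifies over all one-parameter subgroups, so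
it survives translation. -/
lemma translate_conjOneParam (κ : G2 ℝ) (c : OneParam) (φ : G2 ℝ → ℂ) (g : G2 ℝ) :
    (fun t : ℝ => rightReg (G2 ℝ) κ φ (g * c (Multiplicative.ofAdd t))) =
      fun t : ℝ => φ (g * κ * conjOneParam κ⁻¹ c (Multiplicative.ofAdd t)) := by
  funext t
  change φ (g * c (Multiplicative.ofAdd t) * κ) =
    φ (g * κ * (κ⁻¹ * c (Multiplicative.ofAdd t) * κ⁻¹⁻¹))
  simp [mul_assoc]

lemma lieDeriv_translate (κ : G2 ℝ) (c : OneParam) (φ : G2 ℝ → ℂ) :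
    lieDeriv c (rightReg (G2 ℝ) κ φ) = rightReg (G2 ℝ) κ (lieDeriv (conjOneParam κ⁻¹ c) φ) := by
  funext g
  simp only [lieDeriv, translate_conjOneParam]
  rfl

lemma smoothOfOrder_translate (κ : G2 ℝ) (n : ℕ) :
    ∀ φ ∈ smoothOfOrder n, rightReg (G2 ℝ) κ φ ∈ smoothOfOrder n := by
  induction n with
  | zero => exact fun φ hφ => Continuous.comp (g := φ) hφ (continuous_mul_const κ)
  | succ n ih =>
    refine fun φ hφ => ⟨Continuous.comp (g := φ) hφ.1 (continuous_mul_const κ),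
      fun c => ⟨fun g => ?_, ?_⟩⟩
    · rw [translate_conjOneParam]
      exact (hφ.2 _).1 _
    · rw [lieDeriv_translate]
      exact ih _ (hφ.2 _).2

lemma smoothFns_translate (κ : G2 ℝ) {φ : G2 ℝ → ℂ} (hφ : φ ∈ smoothFns) :
    rightReg (G2 ℝ) κ φ ∈ smoothFns :=
  (Submodule.mem_iInf _).2 fun n => smoothOfOrder_translate κ n φ ((Submodule.mem_iInf _).1 hφ n)

lemma Dk_le_smoothFns (k : ℕ) : Dk k ≤ smoothFns :=
  sInf_le ⟨fun _ h _ => h.1, fun κ _ _ hφ => smoothFns_translate κ hφ,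
    fun c _ hφ => smooth_lieDeriv hφ c⟩

lemma Dk_translate {k : ℕ} {κ : G2 ℝ} (hκ : κ ∈ Kinf) {φ : G2 ℝ → ℂ} (hφ : φ ∈ Dk k) :
    rightReg (G2 ℝ) κ φ ∈ Dk k := by
  simp only [Dk, Submodule.mem_sInf] at *
  exact fun W hW => hW.2.1 κ hκ _ (hφ W hW)

lemma Dk_lieDeriv {k : ℕ} (c : OneParam) {φ : G2 ℝ → ℂ} (hφ : φ ∈ Dk k) :
    lieDeriv c φ ∈ Dk k := by
  simp only [Dk, Submodule.mem_sInf] at *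
  exact fun W hW => hW.2.2 c _ (hφ W hW)

/-! ### Stability of `Π(f)` -/

section GlobalPi

variable {k : ℕ} {Sπ : Finset Nat.Primes} {μ : ∀ p : Nat.Primes, ℚ_[p]ˣ →* ℂˣ}

/-- Almost all components of `h` lie in $G_2(\mathbb Z_p)$, where translation preserves both the
invariance and the value $1$ at $1$. -/
lemma globalPi_translate_finite (h : G2Af) {φ : G2A → ℂ} (hφ : φ ∈ globalPi k Sπ μ) :
    rightReg G2A (1, h) φ ∈ globalPi k Sπ μ := by
  induction hφ using Submodule.span_induction with
  | zero => simp
  | add x y _ _ hx hy => rw [map_add]; exact Submodule.add_mem _ hx hy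
  | smul a x _ hx => rw [map_smul]; exact Submodule.smul_mem _ a hx
  | mem x hx =>
    obtain ⟨φinf, hinf, φp, hp, hK, rfl⟩ := hx
    refine Submodule.subset_span ⟨φinf, hinf, fun p => rightReg _ (h p) (φp p),
      fun p => (localPi Sπ μ p).apply_mem_toSubmodule (h p) (hp p), ?_, ?_⟩
    · filter_upwards [hK, h.2] with p hp hhp
      replace hhp : h p ∈ g2Zp p := hhp
      refine ⟨?_, fun κ hκ g => ?_⟩
      · simpa [rightReg, hp.1] using hp.2 _ hhp 1
      · change φp p (g * κ * h p) = φp p (g * h p)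
        rw [mul_assoc, hp.2 _ (mul_mem hκ hhp), hp.2 _ hhp]
    · funext x
      simp [rightReg]

lemma globalPi_translate_compact {κ : G2 ℝ} (hκ : κ ∈ Kinf) {φ : G2A → ℂ}
    (hφ : φ ∈ globalPi k Sπ μ) : rightReg G2A (κ, 1) φ ∈ globalPi k Sπ μ := by
  induction hφ using Submodule.span_induction with
  | zero => simp
  | add x y _ _ hx hy => rw [map_add]; exact Submodule.add_mem _ hx hy
  | smul a x _ hx => rw [map_smul]; exact Submodule.smul_mem _ a hx
  | mem x hx =>
    obtain ⟨φinf, hinf, φp, hp, hK, rfl⟩ := hx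
    refine Submodule.subset_span ⟨_, Dk_translate hκ hinf, φp, hp, hK, ?_⟩
    funext x
    simp [rightReg]

/-- Needed because `deriv` is additive only on differentiable functions: stability under `lieDerivA`
passes from pure tensors to their span through smoothness. -/
lemma globalPi_smooth {φ : G2A → ℂ} (hφ : φ ∈ globalPi k Sπ μ) (y : G2Af) :
    (fun g => φ (g, y)) ∈ smoothFns := by
  induction hφ using Submodule.span_induction with
  | zero => exact Submodule.zero_mem _
  | add x z _ _ hx hz => exact Submodule.add_mem _ hx hz
  | smul a x _ hx => exact Submodule.smul_mem _ a hx
  | mem x hx =>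
    obtain ⟨φinf, hinf, φp, hp, hK, rfl⟩ := hx
    have := Submodule.smul_mem _ (∏ᶠ p, φp p (y p)) (Dk_le_smoothFns k hinf)
    convert this using 1
    funext g
    simp [mul_comm]

lemma globalPi_lieDerivA (c : OneParam) {φ : G2A → ℂ} (hφ : φ ∈ globalPi k Sπ μ) :
    lieDerivA c φ ∈ globalPi k Sπ μ := by
  induction hφ using Submodule.span_induction with
  | zero =>
    have : lieDerivA c 0 = 0 := by funext x; simp [lieDerivA, lieDeriv]
    rw [this]
    exact Submodule.zero_mem _
  | add x z hx hz ihx ihz =>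
    have : lieDerivA c (x + z) = lieDerivA c x + lieDerivA c z := by
      funext y
      exact congrFun (lieDeriv_add (smooth_diff (globalPi_smooth hx y.2) c)
        (smooth_diff (globalPi_smooth hz y.2) c)) y.1
    rw [this]
    exact Submodule.add_mem _ ihx ihz
  | smul a x hx ih =>
    have : lieDerivA c (a • x) = a • lieDerivA c x := by
      funext y
      exact congrFun (lieDeriv_smul a (smooth_diff (globalPi_smooth hx y.2) c)) y.1
    rw [this]
    exact Submodule.smul_mem _ a ih
  | mem x hx =>
    obtain ⟨φinf, hinf, φp, hp, hK, rfl⟩ := hx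
    refine Submodule.subset_span ⟨_, Dk_lieDeriv c hinf, φp, hp, hK, ?_⟩
    funext x
    simp [lieDerivA, lieDeriv]

lemma IsIntertwiner.isAdelicStable_range {T : globalPi k Sπ μ →ₗ[ℂ] (G2A → ℂ)}
    (hT : IsIntertwiner T) : IsAdelicStable (LinearMap.range T) := by
  refine ⟨?_, ?_, ?_⟩
  · rintro h _ ⟨φ, rfl⟩
    exact ⟨⟨_, globalPi_translate_finite h φ.2⟩, hT.finite_equiv h φ _ rfl⟩
  · rintro κ hκ _ ⟨φ, rfl⟩
    exact ⟨⟨_, globalPi_translate_compact hκ φ.2⟩, hT.compact_equiv κ hκ φ _ rfl⟩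
  · rintro c _ ⟨φ, rfl⟩
    exact ⟨⟨_, globalPi_lieDerivA c φ.2⟩, hT.lie_equiv c φ _ rfl⟩

/-! ### The local constituents of the image of `Π(f)` -/

/-- Guards against the default value $1$ of `∏ᶠ` on infinite support, so that a single factor may be
split off. -/
lemma mulSupport_finite {φp : ∀ p : Nat.Primes, G2 ℚ_[p] → ℂ}
    (hK : ∀ᶠ p in Filter.cofinite, φp p 1 = 1 ∧ ∀ κ ∈ g2Zp p, ∀ g, φp p (g * κ) = φp p g)
    (y : G2Af) : (Function.mulSupport fun p => φp p (y p)).Finite := by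
  have : ∀ᶠ p in Filter.cofinite, φp p (y p) = 1 := by
    filter_upwards [hK, y.2] with p hp hy
    replace hy : y p ∈ g2Zp p := hy
    simpa [hp.1] using hp.2 _ hy 1
  exact this

/-- Inserting a vector of `Π_p` at the place `p` of a pure tensor. -/
lemma exists_insert_local (p : Nat.Primes) {φinf : G2 ℝ → ℂ} (hinf : φinf ∈ Dk k)
    {φp : ∀ p : Nat.Primes, G2 ℚ_[p] → ℂ} (hp : ∀ p, φp p ∈ localPi Sπ μ p)
    (hK : ∀ᶠ p in Filter.cofinite, φp p 1 = 1 ∧ ∀ κ ∈ g2Zp p, ∀ g, φp p (g * κ) = φp p g) :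
    ∃ (f : (localPi Sπ μ p).toSubmodule →ₗ[ℂ] globalPi k Sπ μ),
      (∀ h w, (f ((localPi Sπ μ p).toRepresentation h w) : G2A → ℂ) =
        rightReg G2A (g2Incl p h) (f w)) ∧
      (f ⟨φp p, hp p⟩ : G2A → ℂ) = fun x => φinf x.1 * ∏ᶠ p, φp p (x.2 p) := by
  -- The pure tensor with its factor at `p` replaced by $1$. Putting `ψ` at `p` gives
  -- $\psi(x_p)c(x)$, which is linear in `ψ`, and `c` is invariant under $G_2(\mathbb Q_p)$.
  let c : G2A → ℂ := fun x =>
    φinf x.1 * ∏ᶠ q, Function.update φp p (fun _ => 1) q (x.2 q)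
  have hprod : ∀ (ψ : G2 ℚ_[p] → ℂ) (x : G2A),
      φinf x.1 * ∏ᶠ q, Function.update φp p ψ q (x.2 q) = ψ (x.2 p) * c x := by
    intro ψ x
    have hfin : (Function.mulSupport fun q =>
        Function.update φp p (fun _ => 1) q (x.2 q)).Finite := by
      refine (mulSupport_finite hK x.2).subset fun q hq => ?_
      rcases eq_or_ne q p with rfl | hqp
      · simp at hq
      · simpa [hqp] using hq
    have : (fun q => Function.update φp p ψ q (x.2 q)) = fun q =>
        (Pi.mulSingle p (ψ (x.2 p)) : Nat.Primes → ℂ) q *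
          Function.update φp p (fun _ => 1) q (x.2 q) := by
      funext q
      rcases eq_or_ne q p with rfl | hqp
      · simp
      · simp [hqp]
    rw [this, finprod_mul_distrib ((Set.finite_singleton p).subset Pi.mulSupport_mulSingle_subset)
      hfin, finprod_eq_single _ p (fun q hq => by simp [hq])]
    simp only [Pi.mulSingle_eq_same, c]
    ring
  have hmem : ∀ ψ ∈ localPi Sπ μ p, (fun x : G2A => ψ (x.2 p) * c x) ∈ globalPi k Sπ μ := by
    intro ψ hψ
    refine Submodule.subset_span ⟨φinf, hinf, Function.update φp p ψ, fun q => ?_, ?_,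
      funext fun x => (hprod ψ x).symm⟩
    · rcases eq_or_ne q p with rfl | hqp
      · simpa using hψ
      · simpa [hqp] using hp q
    · filter_upwards [hK, (Set.finite_singleton p).compl_mem_cofinite] with q hq hqp
      have hqp : q ≠ p := hqp
      simpa [hqp] using hq
  refine ⟨{ toFun := fun ψ => ⟨_, hmem ψ.1 ψ.2⟩
            map_add' := fun a b => Subtype.ext (funext fun x => add_mul _ _ _)
            map_smul' := fun a b => Subtype.ext (funext fun x => mul_assoc _ _ _) },
    fun h w => ?_, ?_⟩
  · funext x
    have hc : c (x * g2Incl p h) = c x := by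
      have : ∀ q, Function.update φp p (fun _ => 1) q ((x * g2Incl p h).2 q) =
          Function.update φp p (fun _ => 1) q (x.2 q) := by
        intro q
        rcases eq_or_ne q p with rfl | hqp
        · simp
        · simp [g2Incl, hqp]
      simp only [c, this]
      simp [g2Incl]
    change w.1 (x.2 p * h) * c x = w.1 ((x * g2Incl p h).2 p) * c (x * g2Incl p h)
    rw [hc]
    simp [g2Incl]
  · funext x
    change φp p (x.2 p) * c x = _
    rw [← hprod, Function.update_eq_self]

/-- Every irreducible constituent at `p` of the representation generated by `T φ` is a constituent
of `Π_p`. -/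
lemma IsIntertwiner.isSubquotient_localPi {T : globalPi k Sπ μ →ₗ[ℂ] (G2A → ℂ)}
    (hT : IsIntertwiner T) (φ : globalPi k Sπ μ) (p : Nat.Primes)
    {U : Type} [AddCommGroup U] [Module ℂ U] {σ : Representation ℂ (G2 ℚ_[p]) U}
    (hσ : σ.IsIrreducible) (h : IsSubquotient σ (generatedRep (T φ) p).toRepresentation) :
    IsSubquotient σ (localPi Sπ μ p).toRepresentation := by
  have key : ∀ ψ (hψ : ψ ∈ globalPi k Sπ μ), T ⟨ψ, hψ⟩ ∈ Submodule.span ℂ (equivariantImages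
      (localPi Sπ μ p).toRepresentation ((rightReg G2A).comp (g2Incl p))) := by
    intro ψ hψ
    induction hψ using Submodule.span_induction with
    | zero => exact (map_zero T).symm ▸ Submodule.zero_mem _
    | add x y hx hy ihx ihy =>
      exact (map_add T ⟨x, hx⟩ ⟨y, hy⟩).symm ▸ Submodule.add_mem _ ihx ihy
    | smul a x hx ih => exact (map_smul T a ⟨x, hx⟩).symm ▸ Submodule.smul_mem _ a ih
    | mem x hx =>
      obtain ⟨φinf, hinf, φp, hp, hK, rfl⟩ := id hx
      obtain ⟨f, hf, hfx⟩ := exists_insert_local p hinf hp hK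
      refine Submodule.subset_span ⟨T ∘ₗ f, ⟨φp p, hp p⟩,
        fun h w => hT.finite_equiv _ _ _ (hf h w), ?_⟩
      exact congrArg T (Subtype.ext hfx)
  refine IsSubquotient.of_forall_mem_span hσ (fun F hF => ?_) h
  -- $\Pi_F$ is the smallest stable subspace containing $T\varphi$, and the range of `T` is one such
  -- subspace.
  obtain ⟨⟨ψ, hψ⟩, rfl⟩ : F ∈ LinearMap.range T :=
    Submodule.mem_sInf.1 hF _ ⟨hT.isAdelicStable_range, φ, rfl⟩
  exact key ψ hψ

end GlobalPi

/-! ### From the Heisenberg parabolic to the Borel subgroup -/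

section Embedding

variable {p : Nat.Primes}

/-- The quasi-character `u ↦ |u|^t` of `ℚ_pˣ`. -/
noncomputable def absPow (p : Nat.Primes) (t : ℝ) : ℚ_[p]ˣ →* ℂˣ where
  toFun u := Units.mk0 (((‖(u : ℚ_[p])‖ ^ t : ℝ) : ℂ)) (by
    have := Real.rpow_pos_of_pos (norm_pos_iff.2 u.ne_zero) t
    exact_mod_cast this.ne')
  map_one' := by ext; simp
  map_mul' u v := by
    ext
    simp [Real.mul_rpow (norm_nonneg _) (norm_nonneg _)]

lemma absPow_coe (t : ℝ) (u : ℚ_[p]ˣ) :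
    (absPow p t u : ℂ) = ((‖(u : ℚ_[p])‖ ^ t : ℝ) : ℂ) := rfl

lemma isUnramified_absPow (t : ℝ) : IsUnramified (absPow p t) := fun u hu => by
  ext
  simp [absPow_coe, hu]

lemma IsUnramified.mul {χ χ' : ℚ_[p]ˣ →* ℂˣ} (h : IsUnramified χ) (h' : IsUnramified χ') :
    IsUnramified (χ * χ') := fun u hu => by simp [h u hu, h' u hu]

lemma twist_mul_absPow (μ : ℚ_[p]ˣ →* ℂˣ) (t r : ℝ) (u : ℚ_[p]ˣ) :
    twist (μ * absPow p t) r u = twist μ (t + r) u := by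
  simp only [twist, MonoidHom.mul_apply, Units.val_mul, absPow_coe, mul_assoc]
  rw [← Complex.ofReal_mul, ← Real.rpow_add (norm_pos_iff.2 u.ne_zero)]

lemma twist_mul (μ : ℚ_[p]ˣ →* ℂˣ) (t : ℝ) (u v : ℚ_[p]ˣ) :
    twist μ t (u * v) = twist μ t u * twist μ t v := by
  simp only [twist, map_mul, Units.val_mul, norm_mul,
    Real.mul_rpow (norm_nonneg _) (norm_nonneg _), Complex.ofReal_mul]
  ring

/-- The degenerate principal series `I(s, μ)` lies in the full principal series attached to
`μ|·|^{s-1/2} ⊗ μ|·|^{s+1/2}`. -/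
lemma indP_le_indB (s : ℝ) (μ : ℚ_[p]ˣ →* ℂˣ) :
    indP p s μ ≤ indB p (μ * absPow p (s - 1 / 2)) (μ * absPow p (s + 1 / 2)) := by
  rintro φ ⟨hφ, h⟩
  refine ⟨hφ, ?_⟩
  rintro ⟨b, c⟩ ⟨u₁, u₂, ⟨hP, h16⟩, h66, h11, rfl⟩ g
  -- On $B$ the entry $(1,6)$ vanishes, so $\det=u_1u_2$. The exponents match after normalization:
  -- $s+\tfrac32=(s-\tfrac12)+2=(s+\tfrac12)+1$.
  have := h (b, twist μ (s + 3 / 2) (u₁ * u₂)) ⟨u₁ * u₂, hP, by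
    simp only [detP, h16, h66, h11, Units.val_mul]
    ring, rfl⟩ g
  rw [this, twist_mul_absPow, twist_mul_absPow, twist_mul]
  ring_nf

lemma absPow_uniformizer (t : ℝ) :
    (absPow p t (uniformizer p) : ℂ) = (((p : ℕ) : ℂ)) ^ (-t : ℂ) := by
  have hp : (0 : ℝ) ≤ (p : ℕ) := Nat.cast_nonneg _
  rw [absPow_coe]
  simp only [uniformizer, Units.val_mk0, Padic.norm_p]
  rw [Real.inv_rpow hp, ← Real.rpow_neg hp, Complex.ofReal_cpow hp]
  simp

end Embedding

/-! ### The identity of Euler factors -/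

section EulerFactors

/-- The pairs $(1,2)$, $(0,1)$, $(0,2)$ contribute $a$, $b$, $ab$; the reversed pairs contribute the
inverses. -/
lemma stdEulerFactor_eq (a b X : ℂ) :
    stdEulerFactor a b X = ((1 - X) * ((1 - a * X) * (1 - a⁻¹ * X)) *
      ((1 - b * X) * (1 - b⁻¹ * X)) * ((1 - a * b * X) * (1 - (a * b)⁻¹ * X)))⁻¹ := by
  have : (Finset.univ : Finset (Fin 3)).offDiag =
      {(0, 1), (1, 0), (0, 2), (2, 0), (1, 2), (2, 1)} := by decide
  rw [stdEulerFactor, this]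
  simp [Pi.single_apply]
  ring

/-- With $q=p^{1/2}$, the weights $1,\alpha^{\pm2}$ form $\mathrm{Sym}^2$, where $\alpha^2=(\alpha
q)(\alpha q^{-1})$; the weights $\alpha^{\pm1}q$ form the factor at $s-\tfrac12$ and
$\alpha^{\pm1}q^{-1}$ the one at $s+\tfrac12$. -/
lemma stdEulerFactor_lift (p : Nat.Primes) {α : ℂ} (hα : α ≠ 0) (s : ℂ) :
    stdEulerFactor (α * ((p : ℕ) : ℂ) ^ (1 / 2 : ℂ)) (α * ((p : ℕ) : ℂ) ^ (-(1 / 2) : ℂ))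
      (((p : ℕ) : ℂ) ^ (-s)) =
    sym2LFactor p α s * gl2LFactor p α (s + 1 / 2) * gl2LFactor p α (s - 1 / 2) := by
  have hp : ((p : ℕ) : ℂ) ≠ 0 := Nat.cast_ne_zero.2 p.2.ne_zero
  have h1 : ((p : ℕ) : ℂ) ^ (-(s + 1 / 2)) =
      ((p : ℕ) : ℂ) ^ (-s) * (((p : ℕ) : ℂ) ^ (1 / 2 : ℂ))⁻¹ := by
    rw [← Complex.cpow_neg, ← Complex.cpow_add _ _ hp]
    ring_nf
  have h2 : ((p : ℕ) : ℂ) ^ (-(s - 1 / 2)) =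
      ((p : ℕ) : ℂ) ^ (-s) * ((p : ℕ) : ℂ) ^ (1 / 2 : ℂ) := by
    rw [← Complex.cpow_add _ _ hp]
    ring_nf
  have hq : ((p : ℕ) : ℂ) ^ (1 / 2 : ℂ) ≠ 0 := by simp [Complex.cpow_eq_zero_iff, hp]
  rw [stdEulerFactor_eq, sym2LFactor, gl2LFactor, gl2LFactor, h1, h2,
    Complex.cpow_neg _ (1 / 2), ← mul_inv, ← mul_inv]
  congr 1
  generalize ((p : ℕ) : ℂ) ^ (1 / 2 : ℂ) = q at *
  generalize ((p : ℕ) : ℂ) ^ (-s) = X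
  have e1 : α * q * (α * q⁻¹) = α ^ 2 := by field_simp
  rw [e1, inv_pow, mul_inv, mul_inv α, inv_inv]
  ring

/-! ### Convergence -/

/-- $(1-z)^{-1}-1=z(1-z)^{-1}$ has norm at most $2|z|$ once $|z|<\tfrac12$, which fails for only
finitely many indices. -/
lemma multipliable_one_sub_inv {ι : Type*} {z : ι → ℂ} (hz : Summable fun i => ‖z i‖) :
    Multipliable fun i => (1 - z i)⁻¹ := by
  have h12 : ∀ᶠ i in Filter.cofinite, ‖z i‖ < 1 / 2 :=
    hz.tendsto_cofinite_zero.eventually_lt_const (by norm_num)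
  have hsum : Summable fun i => ‖(1 - z i)⁻¹ - 1‖ := by
    refine Summable.of_norm_bounded_eventually (g := fun i => 2 * ‖z i‖) (hz.mul_left 2) ?_
    filter_upwards [h12] with i hi
    have h1 : 1 / 2 ≤ ‖1 - z i‖ := by
      have := norm_sub_norm_le (1 : ℂ) (z i)
      rw [norm_one] at this
      linarith
    have hne : 1 - z i ≠ 0 := norm_pos_iff.1 (by linarith)
    have : (1 - z i)⁻¹ - 1 = z i * (1 - z i)⁻¹ := by
      field_simp
      ring
    rw [norm_norm, this, norm_mul, norm_inv, mul_comm]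
    gcongr
    rw [inv_le_comm₀ (by linarith) two_pos]
    linarith
  simpa using multipliable_one_add_of_summable hsum

lemma summable_norm_mul_cpow {A : Set Nat.Primes} {c : Nat.Primes → ℂ} (hc : ∀ p, ‖c p‖ = 1)
    {s : ℂ} (hs : 1 < s.re) :
    Summable fun p : A => ‖c p * (((p : Nat.Primes) : ℕ) : ℂ) ^ (-s)‖ := by
  have : Summable fun p : Nat.Primes => ((p : ℕ) : ℝ) ^ (-s.re) :=
    Nat.Primes.summable_rpow.2 (by linarith)
  refine (this.comp_injective (Subtype.val_injective (p := (· ∈ A)))).congr fun p => ?_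
  rw [norm_mul, hc, one_mul, Complex.norm_natCast_cpow_of_pos p.1.2.pos]
  simp

lemma multipliable_gl2LFactor {A : Set Nat.Primes} {α : Nat.Primes → ℂ} (hα : ∀ p, ‖α p‖ = 1)
    {s : ℂ} (hs : 1 < s.re) : Multipliable fun p : A => gl2LFactor p (α p) s := by
  simp only [gl2LFactor, mul_inv]
  exact (multipliable_one_sub_inv (summable_norm_mul_cpow hα hs)).mul
    (multipliable_one_sub_inv (summable_norm_mul_cpow (c := fun p => (α p)⁻¹)
      (fun p => by simp [hα]) hs))

lemma multipliable_sym2LFactor {A : Set Nat.Primes} {α : Nat.Primes → ℂ} (hα : ∀ p, ‖α p‖ = 1)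
    {s : ℂ} (hs : 1 < s.re) : Multipliable fun p : A => sym2LFactor p (α p) s := by
  simp only [sym2LFactor, mul_inv]
  refine ((multipliable_one_sub_inv (summable_norm_mul_cpow (c := fun p => α p ^ 2)
    (fun p => by simp [hα]) hs)).mul (multipliable_one_sub_inv ?_)).mul
    (multipliable_one_sub_inv (summable_norm_mul_cpow (c := fun p => (α p)⁻¹ ^ 2)
      (fun p => by simp [hα]) hs))
  simpa using summable_norm_mul_cpow (c := fun _ => 1) (A := A) (by simp) hs

end EulerFactors

/-! ### Spherical vectors on $GL_2$ and unramified parameters -/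

section GL2

variable {p : Nat.Primes}

lemma mem_gl2Zp_of_entries {κ : GL (Fin 2) ℚ_[p]} {A : Matrix (Fin 2) (Fin 2) ℤ_[p]}
    (hA : IsUnit A.det) (h : ∀ i j, κ i j = A i j) : κ ∈ gl2Zp p :=
  ⟨Matrix.GeneralLinearGroup.mk'' A hA, by ext i j; exact (h i j).symm⟩

/-- Iwasawa decomposition: the lower left entry can be cleared by `GL₂(ℤ_p)`. -/
lemma exists_mul_apply_one_zero_eq_zero (g : GL (Fin 2) ℚ_[p]) :
    ∃ κ ∈ gl2Zp p, (g * κ) 1 0 = 0 := by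
  have hdet : g.1.det ≠ 0 := g.det.ne_zero
  rw [Matrix.det_fin_two] at hdet
  -- Dividing by the larger bottom entry puts the ratio in $\mathbb Z_p$, so the clearing column
  -- operation is integral; the second case also swaps the columns.
  rcases le_or_gt ‖g 1 0‖ ‖g 1 1‖ with h | h
  · have hd : g 1 1 ≠ 0 := by
      intro h0
      rw [h0, norm_zero, norm_le_zero_iff] at h
      exact hdet (by simp [h0, h])
    let z : ℤ_[p] := ⟨-(g 1 0 / g 1 1), by
      rw [norm_neg, norm_div]; exact div_le_one_of_le₀ h (norm_nonneg _)⟩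
    refine ⟨Matrix.GeneralLinearGroup.mkOfDetNeZero !![1, 0; -(g 1 0 / g 1 1), 1] (by simp),
      mem_gl2Zp_of_entries (A := !![1, 0; z, 1]) (by simp) fun i j => ?_, ?_⟩
    · fin_cases i <;> fin_cases j <;> simp [Matrix.GeneralLinearGroup.mkOfDetNeZero, z]
    · simp [Matrix.mul_apply, Fin.sum_univ_two, Matrix.GeneralLinearGroup.mkOfDetNeZero]
      field_simp
      ring
  · have hc : g 1 0 ≠ 0 := norm_pos_iff.1 ((norm_nonneg _).trans_lt h)
    let z : ℤ_[p] := ⟨g 1 1 / g 1 0, by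
      rw [norm_div]; exact div_le_one_of_le₀ h.le (norm_nonneg _)⟩
    refine ⟨Matrix.GeneralLinearGroup.mkOfDetNeZero !![g 1 1 / g 1 0, 1; -1, 0] (by simp),
      mem_gl2Zp_of_entries (A := !![z, 1; -1, 0]) (by simp) fun i j => ?_, ?_⟩
    · fin_cases i <;> fin_cases j <;> simp [Matrix.GeneralLinearGroup.mkOfDetNeZero, z]
    · simp [Matrix.mul_apply, Fin.sum_univ_two, Matrix.GeneralLinearGroup.mkOfDetNeZero]
      field_simp
      ring

/-- A principal series with a nonzero `GL₂(ℤ_p)`-fixed vector has unramified parameter. -/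
lemma isUnramified_of_fixed {μ : ℚ_[p]ˣ →* ℂˣ} {φ : GL (Fin 2) ℚ_[p] → ℂ}
    (hφ : φ ∈ gl2Ind p (twist μ 0) (twist μ⁻¹ 0)) (h0 : φ ≠ 0)
    (hfix : ∀ κ ∈ gl2Zp p, ∀ g, φ (g * κ) = φ g) : IsUnramified μ := by
  -- By the Iwasawa decomposition, $\varphi(g)$ is a multiple of $\varphi(1)$ for every $g$.
  have h1 : φ 1 ≠ 0 := by
    intro h1
    refine h0 (funext fun g => ?_)
    obtain ⟨κ, hκ, h10⟩ := exists_mul_apply_one_zero_eq_zero g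
    have hdet : (g * κ).1.det ≠ 0 := (g * κ).det.ne_zero
    rw [Matrix.det_fin_two, show (g * κ).1 1 0 = 0 from h10, mul_zero, sub_zero] at hdet
    have := hφ.2 (g * κ, _) ⟨Units.mk0 _ (left_ne_zero_of_mul hdet),
      Units.mk0 _ (right_ne_zero_of_mul hdet), h10, rfl, rfl, rfl⟩ 1
    rw [← hfix κ hκ, Pi.zero_apply]
    simpa [h1] using this
  intro u hu
  let κ : GL (Fin 2) ℚ_[p] := Matrix.GeneralLinearGroup.mkOfDetNeZero !![(u : ℚ_[p]), 0; 0, 1]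
    (by simp)
  let z : ℤ_[p] := ⟨u, hu.le⟩
  have hz : IsUnit z := PadicInt.isUnit_iff.2 hu
  have hκ : κ ∈ gl2Zp p := by
    refine mem_gl2Zp_of_entries (A := !![z, 0; 0, 1]) (by simpa using hz) fun i j => ?_
    fin_cases i <;> fin_cases j <;> simp [Matrix.GeneralLinearGroup.mkOfDetNeZero, z, κ]
  -- $\mathrm{diag}(u,1)$ is both upper triangular and integral: comparing the two transformation
  -- laws gives $\mu(u)=1$, the modulus being trivial on units.
  have h2 := hφ.2 (κ, _) ⟨u, 1, rfl, rfl, rfl, rfl⟩ 1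
  have h3 := hfix κ hκ 1
  rw [one_mul] at h3
  rw [mul_one, h3] at h2
  simp only [twist, hu] at h2
  ext
  simpa [h1] using h2

/-- $SL_2(\mathbb R)$ is transitive on the upper half plane and the automorphy factor never
vanishes, so $\Phi$ determines $f$. -/
lemma IsAdelization.ne_zero {C k : ℕ} {f : CuspForm (Gamma0R C) ((2 * k : ℕ) : ℤ)}
    {Φ : GL2A → ℂ} (hΦ : IsAdelization C k f Φ) (hf : f ≠ 0) : Φ ≠ 0 := by
  rintro rfl
  refine hf (DFunLike.ext _ _ fun τ => ?_)
  have hdet : 0 < ((Matrix.SpecialLinearGroup.toGL τ.toSL2R).det : ℝ) := by simp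
  have h := hΦ.at_infinity (Matrix.SpecialLinearGroup.toGL τ.toSL2R) hdet
  have hτ : Matrix.SpecialLinearGroup.toGL τ.toSL2R • UpperHalfPlane.I = τ := by
    conv_rhs => rw [← UpperHalfPlane.toSL2R_smul_I τ]
    rfl
  rw [hτ] at h
  have hden : UpperHalfPlane.denom (Matrix.SpecialLinearGroup.toGL τ.toSL2R) Complex.I ≠ 0 :=
    UpperHalfPlane.denom_ne_zero _ UpperHalfPlane.I
  simpa [hden] using h.symm

/-- For $p\nmid C$ the integer $C$ is a $p$-adic unit, so the congruence defining $K_0(C)$ is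
vacuous at $p$. -/
lemma IsAdelization.fixed {C k : ℕ} {f : CuspForm (Gamma0R C) ((2 * k : ℕ) : ℤ)}
    {Φ : GL2A → ℂ} (hΦ : IsAdelization C k f Φ) (hp : ¬ (p : ℕ) ∣ C)
    {κ : GL (Fin 2) ℚ_[p]} (hκ : κ ∈ gl2Zp p) (x : GL2A) : Φ (x * gl2Incl p κ) = Φ x := by
  refine hΦ.right_inv _ (fun q => ?_) x
  rcases eq_or_ne q p with rfl | hq
  · have hC : ‖(C : ℚ_[q])‖ = 1 := by
      rw [Padic.norm_natCast_eq_one_iff]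
      exact (Nat.Prime.coprime_iff_not_dvd q.2).2 hp
    obtain ⟨A, rfl⟩ := id hκ
    refine ⟨by simpa using hκ, ?_⟩
    rw [hC]
    simpa using (A 1 0).norm_le_one
  · simp [hq, one_mem]

lemma isUnramified_of_isPrincipalSeries {C k : ℕ}
    {f : CuspForm (Gamma0R C) ((2 * k : ℕ) : ℤ)} (hf : f ≠ 0)
    {Φ : GL2A → ℂ} (hΦ : IsAdelization C k f Φ) (hp : ¬ (p : ℕ) ∣ C) {μ : ℚ_[p]ˣ →* ℂˣ}
    (h : IsPrincipalSeries (gl2Local Φ p).toRepresentation μ) : IsUnramified μ := by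
  obtain ⟨e⟩ := h
  let v : (gl2Local Φ p).toSubmodule := ⟨Φ, Submodule.subset_span ⟨1, by simp⟩⟩
  have hv : ∀ κ ∈ gl2Zp p, (gl2Local Φ p).toRepresentation κ v = v := fun κ hκ =>
    Subtype.ext (funext fun x => hΦ.fixed hp hκ x)
  refine isUnramified_of_fixed (e v).2 (fun h0 => hΦ.ne_zero hf ?_) fun κ hκ g => ?_
  · have : v = 0 := e.injective ((Subtype.ext h0 : e v = 0).trans (map_zero e).symm)
    exact congrArg Subtype.val this
  · have := IntertwiningMap.isIntertwining _ _ e.toIntertwiningMap κ v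
    rw [hv κ hκ] at this
    exact (congrFun (congrArg Subtype.val this) g).symm

end GL2

end GGLift

/-! ### The standard $L$-function of the lift -/

theorem theorem11p1 (k C : ℕ) (hk : 2 ≤ k) (hk_even : Even k) (hC : 0 < C)
    (f : CuspForm (Gamma0R C) ((2 * k : ℕ) : ℤ)) (hf : f ≠ 0)
    (Φ : GL2A → ℂ) (hΦ : IsAdelization C k f Φ)
    (Sπ : Finset Nat.Primes) (μ : ∀ p : Nat.Primes, ℚ_[p]ˣ →* ℂˣ)
    (hμ_cont : ∀ p, Continuous (μ p)) (hμ_unitary : ∀ p u, ‖(μ p u : ℂ)‖ = 1)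
    (hπ_ps : ∀ p ∉ Sπ, IsPrincipalSeries (gl2Local Φ p).toRepresentation (μ p))
    (hπ_st : ∀ p ∈ Sπ, (μ p) ^ 2 = 1 ∧
      IsTwistedSteinberg (gl2Local Φ p).toRepresentation (μ p))
    (T : globalPi k Sπ μ →ₗ[ℂ] (G2A → ℂ)) (hT : IsIntertwiner T)
    (φ : globalPi k Sπ μ) (hF : T φ ≠ 0)
    (S : Set Nat.Primes) (hS : S = {p | p ∈ Sπ ∨ (p : ℕ) ∣ C}) :
    (∀ p ∉ S, IsUnramified (μ p)) ∧
    ∃ L : Nat.Primes → ℂ → ℂ,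
      (∀ p ∉ S, IsStdLFactor (generatedRep (T φ) p).toRepresentation (L p)) ∧
      (∀ p ∉ S, ∀ s, L p s = sym2LFactor p (μ p (uniformizer p)) s *
        gl2LFactor p (μ p (uniformizer p)) (s + 1 / 2) *
        gl2LFactor p (μ p (uniformizer p)) (s - 1 / 2)) ∧
      ∀ s : ℂ, 3 / 2 < s.re →
        Multipliable (fun p : {p // p ∉ S} => L p s) ∧
        Multipliable (fun p : {p // p ∉ S} => sym2LFactor p (μ p (uniformizer p)) s) ∧
        Multipliable (fun p : {p // p ∉ S} =>
          gl2LFactor p (μ p (uniformizer p)) (s + 1 / 2)) ∧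
        Multipliable (fun p : {p // p ∉ S} =>
          gl2LFactor p (μ p (uniformizer p)) (s - 1 / 2)) ∧
        ∏' p : {p // p ∉ S}, L p s =
          (∏' p : {p // p ∉ S}, sym2LFactor p (μ p (uniformizer p)) s) *
          (∏' p : {p // p ∉ S}, gl2LFactor p (μ p (uniformizer p)) (s + 1 / 2)) *
          ∏' p : {p // p ∉ S}, gl2LFactor p (μ p (uniformizer p)) (s - 1 / 2) := by
  have hS_ps : ∀ p ∉ S, p ∉ Sπ ∧ ¬ (p : ℕ) ∣ C := fun p hp => by simpa [hS] using hp
  have hunr : ∀ p ∉ S, IsUnramified (μ p) := fun p hp =>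
    isUnramified_of_isPrincipalSeries hf hΦ (hS_ps p hp).2 (hπ_ps p (hS_ps p hp).1)
  refine ⟨hunr, fun p s => sym2LFactor p (μ p (uniformizer p)) s *
    gl2LFactor p (μ p (uniformizer p)) (s + 1 / 2) *
    gl2LFactor p (μ p (uniformizer p)) (s - 1 / 2), fun p hp => ?_, fun _ _ _ => rfl,
    fun s hs => ?_⟩
  · refine ⟨⟨⟨T φ, Submodule.mem_sInf.2 fun W hW => hW.2⟩, 0, fun h => hF (congrArg Subtype.val h)⟩,
      _, _, (hunr p hp).mul (isUnramified_absPow (0 - 1 / 2)),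
      (hunr p hp).mul (isUnramified_absPow (0 + 1 / 2)), fun U _ _ σ hσ h => ?_, fun s => ?_⟩
    · have := hT.isSubquotient_localPi φ p hσ h
      rw [localPi, if_neg (hS_ps p hp).1] at this
      exact this.mono (indP_le_indB 0 (μ p))
    · refine (stdEulerFactor_lift p (Units.ne_zero _) s).symm.trans ?_
      simp [absPow_uniformizer]
  · have hα : ∀ p, ‖(μ p (uniformizer p) : ℂ)‖ = 1 := fun p => hμ_unitary p _
    have h1 := multipliable_sym2LFactor (A := Sᶜ) hα (s := s) (by linarith)
    have h2 := multipliable_gl2LFactor (A := Sᶜ) hα (s := s + 1 / 2) (by norm_num; linarith)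
    -- This factor dictates the bound $\tfrac32$: the shifted argument must have real part greater
    -- than $1$.
    have h3 := multipliable_gl2LFactor (A := Sᶜ) hα (s := s - 1 / 2) (by norm_num; linarith)
    exact ⟨(h1.mul h2).mul h3, h1, h2, h3, ((h1.mul h2).tprod_mul h3).trans
      (congrArg (· * _) (h1.tprod_mul h2))⟩
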